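/- Let $\alpha>0$ and let $F=\mathbb R\times H^2$, where $H^2=\{(x,y)\in\mathbb R^2: y>0\}$ is the Poincaré half-plane of Gaussian curvature $-\alpha$; $F$ carries the metric $g_F=\frac{1}{\alpha y^2}(dx^2+dy^2)+dz^2$. Put $e_2=\sqrt\alpha\,y\,\partial_x$ and $e_3=\partial_z$. Let $I\subset\mathbb R$ be a non-empty open interval, let $f:I\to(0,\infty)$ and $\varphi:I\to\mathbb R$ be smooth, and let $b,c:(0,\infty)\to\mathbb R$ be smooth functions that are not both identically zero. Consider on the warped product $I\times_f F$, with metric $g=dt^2+f(t)^2g_F$, the vector field $$V=\varphi(t)\,\partial_t+b(y)\,e_2+c(y)\,e_3 .$$ A vector field $V$ on an $m$-dimensional Riemannian manifold is called harmonic if it is a critical point, for every compact $D$ and with respect to variations through vector fields supported in $D$, of the energy $E(V)=\frac m2\operatorname{Vol}(D)+\frac12\int_D\|\nabla V\|^2v_g$. Then $V$ is harmonic if and only if $$\varphi''+3\frac{f'}{f}\varphi'-3\Big(\frac{f'}{f}\Big)^2\varphi=0\quad\text{on } I$$ and there is a constant $\varepsilon\in\mathbb R$ such that $$ff''+2f'^2=\varepsilon\quad\text{on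 } I$$ and, on $(0,\infty)$, $$\alpha y^2b''(y)=(\alpha-\varepsilon)\,b(y),\qquad \alpha y^2c''(y)=-\varepsilon\,c(y).$$ Equivalently, $V$ is harmonic if and only if the equation for $\varphi$ holds and there is a constant $\varepsilon\in\mathbb R$ such that $ff''+2f'^2=\varepsilon$ on $I$ and $c$, $b$ have the following explicit form on $(0,\infty)$, for some constants $\kappa_1,\kappa_2\in\mathbb R$ (chosen separately for $c$ and for $b$): $$c(y)=\begin{cases} y^{1/2}\big(\kappa_1+\kappa_2\ln y\big) & \text{if } \alpha=4\varepsilon,\\[2pt] \kappa_1\,y^{\frac12+\frac12\sqrt{1-4\varepsilon/\alpha}}+\kappa_2\,y^{\frac12-\frac12\sqrt{1-4\varepsilon/\alpha}} & \text{if } 4\varepsilon<\alpha,\\[2pt] y^{1/2}\Big(\kappa_1\cos\big(\tfrac12\sqrt{4\varepsilon/\alpha-1}\,\ln y\big)+\kappa_2\sin\big(\tfrac12\sqrt{4\varepsilon/\alpha-1}\,\ln y\big)\Big) & \text{if } \alpha<4\varepsilon,\end{cases}$$ $$b(y)=\begin{cases} y^{1/2}\big(\kappa_1+\kappa_2\ln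 y\big) & \text{if } 4\varepsilon=5\alpha,\\[2pt] \kappa_1\,y^{\frac12+\frac12\sqrt{5-4\varepsilon/\alpha}}+\kappa_2\,y^{\frac12-\frac12\sqrt{5-4\varepsilon/\alpha}} & \text{if } 4\varepsilon<5\alpha,\\[2pt] y^{1/2}\Big(\kappa_1\cos\big(\tfrac12\sqrt{4\varepsilon/\alpha-5}\,\ln y\big)+\kappa_2\sin\big(\tfrac12\sqrt{4\varepsilon/\alpha-5}\,\ln y\big)\Big) & \text{if } 5\alpha<4\varepsilon.\end{cases}$$ -/

import Mathlib

open MeasureTheory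
open scoped ContDiff

noncomputable section

namespace WarpedHarmonic

/-! Riemannian geometry in a global chart: `M` is an open set of `ι → ℝ`, the metric is the matrix
`g p = (g_{ij}(p))`, a vector field is the tuple `V p = (V^k(p))` of its components in the
coordinate frame. -/

/-- The `i`-th partial derivative of `h` at `p`. -/
def pderiv {ι : Type} [Fintype ι] [DecidableEq ι] (i : ι) (h : (ι → ℝ) → ℝ) (p : ι → ℝ) : ℝ :=
  fderiv ℝ h p (Pi.single i 1)

/-- Christoffel symbols `Γ^k_{ij}` of the Levi-Civita connection. -/
def christoffel {ι : Type} [Fintype ι] [DecidableEq ι] (g : (ι → ℝ) → Matrix ι ι ℝ)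
    (k i j : ι) (p : ι → ℝ) : ℝ :=
  (1 / 2) * ∑ l, (g p)⁻¹ k l *
    (pderiv i (fun q => g q j l) p + pderiv j (fun q => g q i l) p - pderiv l (fun q => g q i j) p)

/-- The component `(∇_{∂_i} V)^k` of the Levi-Civita covariant derivative. -/
def covDeriv {ι : Type} [Fintype ι] [DecidableEq ι] (g : (ι → ℝ) → Matrix ι ι ℝ)
    (V : (ι → ℝ) → (ι → ℝ)) (i k : ι) (p : ι → ℝ) : ℝ :=
  pderiv i (fun q => V q k) p + ∑ j, christoffel g k i j p * V p j

/-- `‖∇V‖² = g^{ij} g_{kl} (∇_i V)^k (∇_j V)^l`. -/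
def covDerivNormSq {ι : Type} [Fintype ι] [DecidableEq ι] (g : (ι → ℝ) → Matrix ι ι ℝ)
    (V : (ι → ℝ) → (ι → ℝ)) (p : ι → ℝ) : ℝ :=
  ∑ i, ∑ j, ∑ k, ∑ l, (g p)⁻¹ i j * g p k l * covDeriv g V i k p * covDeriv g V j l p

/-- The energy over `D` of the vector field `V`, as a map into the tangent bundle with its Sasaki
metric: `E(V) = (m / 2) Vol(D) + (1 / 2) ∫_D ‖∇V‖² v_g`. -/
def energy {ι : Type} [Fintype ι] [DecidableEq ι] (g : (ι → ℝ) → Matrix ι ι ℝ)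
    (D : Set (ι → ℝ)) (V : (ι → ℝ) → (ι → ℝ)) : ℝ :=
  (Fintype.card ι : ℝ) / 2 * (∫ p in D, Real.sqrt (g p).det) +
    (1 / 2) * ∫ p in D, covDerivNormSq g V p * Real.sqrt (g p).det

/-- `V` is a harmonic vector field on `(M, g)`: a smooth vector field that is a critical point of
the energy over every compact `D ⊆ M`, with respect to variations through vector fields that are
supported in `D`. -/
def IsHarmonicVectorField {ι : Type} [Fintype ι] [DecidableEq ι] (g : (ι → ℝ) → Matrix ι ι ℝ)
    (M : Set (ι → ℝ)) (V : (ι → ℝ) → (ι → ℝ)) : Prop :=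
  ContDiffOn ℝ ∞ V M ∧
    ∀ (D : Set (ι → ℝ)) (W : (ι → ℝ) → (ι → ℝ)), IsCompact D → D ⊆ M →
      ContDiff ℝ ∞ W → tsupport W ⊆ D →
      HasDerivAt (fun s : ℝ => energy g D (fun p => V p + s • W p)) 0 0

/-! Warped products. A point of `B × F` is a tuple indexed by `ι ⊕ κ`. -/

/-- The product `B × F` of two open sets of coordinate spaces. -/
def prodSet {ι κ : Type} (B : Set (ι → ℝ)) (F : Set (κ → ℝ)) : Set (ι ⊕ κ → ℝ) :=
  {p | (fun i => p (Sum.inl i)) ∈ B ∧ (fun j => p (Sum.inr j)) ∈ F}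

/-- The metric `π^* g_B ⊕ (f ∘ π)² σ^* g_F` of the warped product `B ×_f F`. -/
def warpedMetric {ι κ : Type} (gB : (ι → ℝ) → Matrix ι ι ℝ) (f : (ι → ℝ) → ℝ)
    (gF : (κ → ℝ) → Matrix κ κ ℝ) (p : ι ⊕ κ → ℝ) : Matrix (ι ⊕ κ) (ι ⊕ κ) ℝ :=
  Matrix.fromBlocks (gB fun i => p (Sum.inl i)) 0 0
    ((f fun i => p (Sum.inl i)) ^ 2 • gF fun j => p (Sum.inr j))

/-- The vector field `V₁ + V₂` on `B × F`, for vector fields `V₁` on `B` and `V₂` on `F`. -/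
def sumField {ι κ : Type} (V₁ : (ι → ℝ) → (ι → ℝ)) (V₂ : (κ → ℝ) → (κ → ℝ))
    (p : ι ⊕ κ → ℝ) : ι ⊕ κ → ℝ :=
  Sum.elim (V₁ fun i => p (Sum.inl i)) (V₂ fun j => p (Sum.inr j))

/-! The base `I ⊆ ℝ` with metric `dt²`; its coordinate is `t = p ()`. -/

/-- The subset `I` of the line. -/
def lineSet (I : Set ℝ) : Set (Unit → ℝ) := {p | p () ∈ I}

/-- The metric `dt²`. -/
def lineMetric (_ : Unit → ℝ) : Matrix Unit Unit ℝ := 1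

/-! The fibre `ℝ × H²`, with coordinates `(x, y, z) = (q 0, q 1, q 2)`, `y > 0`. -/

/-- The underlying open set `{y > 0}` of `ℝ × H²`. -/
def fibreSet : Set (Fin 3 → ℝ) := {q | 0 < q 1}

/-- The metric `(dx² + dy²) / (α y²) + dz²`. -/
def fibreMetric (α : ℝ) (q : Fin 3 → ℝ) : Matrix (Fin 3) (Fin 3) ℝ :=
  Matrix.diagonal ![1 / (α * q 1 ^ 2), 1 / (α * q 1 ^ 2), 1]

/-- The unit vector field `e₂ = √α y ∂/∂x`. -/
def e₂ (α : ℝ) (q : Fin 3 → ℝ) : Fin 3 → ℝ := ![q 1 * Real.sqrt α, 0, 0]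

/-- The unit vector field `e₃ = ∂/∂z`. -/
def e₃ (_ : Fin 3 → ℝ) : Fin 3 → ℝ := ![0, 0, 1]

/-- The manifold `I × (ℝ × H²)`. -/
def totalSet (I : Set ℝ) : Set (Unit ⊕ Fin 3 → ℝ) := prodSet (lineSet I) fibreSet

/-- The metric of `I ×_f (ℝ × H²)`. -/
def totalMetric (α : ℝ) (f : ℝ → ℝ) :
    (Unit ⊕ Fin 3 → ℝ) → Matrix (Unit ⊕ Fin 3) (Unit ⊕ Fin 3) ℝ :=
  warpedMetric lineMetric (fun p => f (p ())) (fibreMetric α)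

/-- The vector field `φ(t) ∂_t + b(y) e₂ + c(y) e₃`. -/
def totalField (α : ℝ) (φ b c : ℝ → ℝ) : (Unit ⊕ Fin 3 → ℝ) → (Unit ⊕ Fin 3 → ℝ) :=
  sumField (fun p _ => φ (p ())) (fun q => b (q 1) • e₂ α q + c (q 1) • e₃ q)

/-- `x'' + 3 (f'/f) x' - 3 (f'/f)² x = 0` on `I`. -/
def PhiEquation (I : Set ℝ) (f φ : ℝ → ℝ) : Prop :=
  ∀ t ∈ I, deriv (deriv φ) t + 3 * (deriv f t / f t) * deriv φ t
    - 3 * (deriv f t / f t) ^ 2 * φ t = 0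

/-- `f f'' + 2 f'² = ε` on `I`. -/
def WarpingEquation (I : Set ℝ) (ε : ℝ) (f : ℝ → ℝ) : Prop :=
  ∀ t ∈ I, f t * deriv (deriv f) t + 2 * deriv f t ^ 2 = ε

/-- The explicit form of the coefficient `c` of `e₃`. -/
def ExplicitC (α ε : ℝ) (c : ℝ → ℝ) : Prop :=
  ∃ κ₁ κ₂ : ℝ,
    (α = 4 * ε → ∀ y : ℝ, 0 < y →
      c y = y ^ (1 / 2 : ℝ) * (κ₁ + κ₂ * Real.log y)) ∧
    (4 * ε < α → ∀ y : ℝ, 0 < y →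
      c y = κ₁ * y ^ (1 / 2 + 1 / 2 * Real.sqrt (1 - 4 * ε / α))
        + κ₂ * y ^ (1 / 2 - 1 / 2 * Real.sqrt (1 - 4 * ε / α))) ∧
    (α < 4 * ε → ∀ y : ℝ, 0 < y →
      c y = y ^ (1 / 2 : ℝ) *
        (κ₁ * Real.cos (1 / 2 * Real.sqrt (4 * ε / α - 1) * Real.log y)
          + κ₂ * Real.sin (1 / 2 * Real.sqrt (4 * ε / α - 1) * Real.log y)))

/-- The explicit form of the coefficient `b` of `e₂`. -/
def ExplicitB (α ε : ℝ) (b : ℝ → ℝ) : Prop :=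
  ∃ κ₁ κ₂ : ℝ,
    (4 * ε = 5 * α → ∀ y : ℝ, 0 < y →
      b y = y ^ (1 / 2 : ℝ) * (κ₁ + κ₂ * Real.log y)) ∧
    (4 * ε < 5 * α → ∀ y : ℝ, 0 < y →
      b y = κ₁ * y ^ (1 / 2 + 1 / 2 * Real.sqrt (5 - 4 * ε / α))
        + κ₂ * y ^ (1 / 2 - 1 / 2 * Real.sqrt (5 - 4 * ε / α))) ∧
    (5 * α < 4 * ε → ∀ y : ℝ, 0 < y →
      b y = y ^ (1 / 2 : ℝ) *
        (κ₁ * Real.cos (1 / 2 * Real.sqrt (4 * ε / α - 5) * Real.log y)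
          + κ₂ * Real.sin (1 / 2 * Real.sqrt (4 * ε / α - 5) * Real.log y)))

end WarpedHarmonic

end

noncomputable section

namespace WarpedHarmonic

/-! Since `∇` is linear, the energy of `V + s W` is a quadratic polynomial in `s`, and its linear
coefficient is `∫ ⟨∇V, ∇W⟩`. Integration by parts against a compactly supported `W` turns this into
the pairing of `W` with the rough Laplacian of `V`. By the fundamental lemma of the calculus of
variations, `V` is harmonic exactly when its rough Laplacian vanishes (`isHarmonicVectorField_iff`).

For the warped product the metric is diagonal and depends on `t` and `y` only, so the rough
Laplacian can be computed explicitly (`roughLaplacian_totalField`). Its `∂_y` component is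
identically zero. The other three are nowhere vanishing factors times the `φ` equation and two
equations coupling `f f'' + 2 f'²` to `b` and to `c`. At a height `y` where `b` or `c` is nonzero,
the coupled equations force `f f'' + 2 f'²` to be independent of `t` (`exists_separation_constant`).

What remains are Euler equations `y² u'' = k u`, with `k = -ε/α` for `c` and `k = 1 - ε/α` for `b`.
The Wronskian of two solutions is constant, so two independent explicit solutions span them all. The
sign of `1 + 4k` decides the shape. -/

/-! ### Test functions and the fundamental lemma. -/

theorem continuous_mul_of_tsupport_subset {X : Type*} [TopologicalSpace X] {M : Set X} (hM : IsOpen M) {u w : X → ℝ}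
    (hu : ContinuousOn u M) (hw : Continuous w) (hwM : tsupport w ⊆ M) :
    Continuous (fun p => u p * w p) :=
  continuous_of_tsupport fun _ hp => ((hu.continuousAt (hM.mem_nhds
    (hwM (tsupport_mul_subset_right hp)))).mul hw.continuousAt)

theorem tsupport_apply_subset {X ι : Type*} [TopologicalSpace X] (W : X → ι → ℝ) (l : ι) :
    tsupport (fun p => W p l) ⊆ tsupport W :=
  closure_mono fun p hp h => hp (by simp [h])

/-- Testing gives `u = 0` almost everywhere on `M`; continuity on an open set upgrades this to every
point. -/
theorem eqOn_zero_of_integral_mul_eq_zero {ι : Type*} [Fintype ι] {M : Set (ι → ℝ)} (hM : IsOpen M) {u : (ι → ℝ) → ℝ}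
    (hu : ContinuousOn u M) (h : ∀ w : (ι → ℝ) → ℝ, ContDiff ℝ ∞ w → HasCompactSupport w →
      tsupport w ⊆ M → ∫ p, u p * w p = 0) : ∀ p ∈ M, u p = 0 := by
  have hae := hM.ae_eq_zero_of_integral_contDiff_smul_eq_zero (μ := volume)
    (hu.locallyIntegrableOn hM.measurableSet)
    (fun w hw hwc hwM => by simpa only [smul_eq_mul, mul_comm] using h w hw hwc hwM)
  exact Measure.eqOn_open_of_ae_eq ((ae_restrict_iff' hM.measurableSet).2 hae) hM hu
    continuousOn_const

theorem integrable_mul_of_tsupport_subset {ι : Type*} [Fintype ι] {M : Set (ι → ℝ)} (hM : IsOpen M) {u w : (ι → ℝ) → ℝ}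
    (hu : ContinuousOn u M) (hw : Continuous w) (hwc : HasCompactSupport w)
    (hwM : tsupport w ⊆ M) : Integrable (fun p => u p * w p) :=
  (continuous_mul_of_tsupport_subset hM hu hw hwM).integrable_of_hasCompactSupport hwc.mul_left

/-! ### First variation of the energy in a global chart. -/

section Chart

variable {ι : Type} [Fintype ι] [DecidableEq ι]

theorem contDiffOn_pderiv {M : Set (ι → ℝ)} (hM : IsOpen M) (i : ι) {h : (ι → ℝ) → ℝ}
    (hh : ContDiffOn ℝ ∞ h M) : ContDiffOn ℝ ∞ (pderiv i h) M :=
  (hh.fderiv_of_isOpen hM (by simp)).clm_apply contDiffOn_const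

theorem contDiff_pderiv (i : ι) {h : (ι → ℝ) → ℝ} (hh : ContDiff ℝ ∞ h) :
    ContDiff ℝ ∞ (pderiv i h) :=
  contDiffOn_univ.1 (contDiffOn_pderiv isOpen_univ i hh.contDiffOn)

theorem tsupport_pderiv_subset (i : ι) (h : (ι → ℝ) → ℝ) :
    tsupport (pderiv i h) ⊆ tsupport h :=
  tsupport_fderiv_apply_subset ℝ _

theorem contDiffOn_det {M : Set (ι → ℝ)} {A : (ι → ℝ) → Matrix ι ι ℝ}
    (hA : ∀ i j, ContDiffOn ℝ ∞ (fun p => A p i j) M) :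
    ContDiffOn ℝ ∞ (fun p => (A p).det) M := by
  simp only [Matrix.det_apply']
  exact ContDiffOn.sum fun σ _ => contDiffOn_const.mul (contDiffOn_prod fun i _ => hA _ _)

theorem contDiffOn_inv {M : Set (ι → ℝ)} {A : (ι → ℝ) → Matrix ι ι ℝ}
    (hA : ∀ i j, ContDiffOn ℝ ∞ (fun p => A p i j) M) (hdet : ∀ p ∈ M, (A p).det ≠ 0) (i j : ι) :
    ContDiffOn ℝ ∞ (fun p => (A p)⁻¹ i j) M := by
  simp only [Matrix.inv_def, Matrix.smul_apply, Matrix.adjugate_apply, Ring.inverse_eq_inv',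
    smul_eq_mul]
  refine ((contDiffOn_det hA).inv hdet).mul (contDiffOn_det fun k l => ?_)
  simp only [Matrix.updateRow_apply]
  split_ifs
  · exact contDiffOn_const
  · exact hA k l

theorem contDiffOn_christoffel {M : Set (ι → ℝ)} (hM : IsOpen M) {g : (ι → ℝ) → Matrix ι ι ℝ}
    (hg : ∀ i j, ContDiffOn ℝ ∞ (fun p => g p i j) M) (hdet : ∀ p ∈ M, (g p).det ≠ 0) (k i j : ι) :
    ContDiffOn ℝ ∞ (christoffel g k i j) M :=
  contDiffOn_const.mul (ContDiffOn.sum fun l _ => (contDiffOn_inv hg hdet k l).mul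
    (((contDiffOn_pderiv hM i (hg j l)).add (contDiffOn_pderiv hM j (hg i l))).sub
      (contDiffOn_pderiv hM l (hg i j))))

theorem contDiffOn_covDeriv {M : Set (ι → ℝ)} (hM : IsOpen M) {g : (ι → ℝ) → Matrix ι ι ℝ}
    (hg : ∀ i j, ContDiffOn ℝ ∞ (fun p => g p i j) M) (hdet : ∀ p ∈ M, (g p).det ≠ 0)
    {V : (ι → ℝ) → ι → ℝ} (hV : ContDiffOn ℝ ∞ V M) (i k : ι) :
    ContDiffOn ℝ ∞ (covDeriv g V i k) M :=
  (contDiffOn_pderiv hM i (contDiffOn_pi.1 hV k)).add (ContDiffOn.sum fun j _ =>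
    (contDiffOn_christoffel hM hg hdet k i j).mul (contDiffOn_pi.1 hV j))

theorem covDeriv_add_smul (g : (ι → ℝ) → Matrix ι ι ℝ) {V W : (ι → ℝ) → ι → ℝ} {p : ι → ℝ}
    (hV : DifferentiableAt ℝ V p) (hW : DifferentiableAt ℝ W p) (s : ℝ) (i k : ι) :
    covDeriv g (fun q => V q + s • W q) i k p = covDeriv g V i k p + s * covDeriv g W i k p := by
  have hV' := differentiableAt_pi.1 hV k
  have hW' := differentiableAt_pi.1 hW k
  have h : pderiv i (fun q => (V q + s • W q) k) p
      = pderiv i (fun q => V q k) p + s * pderiv i (fun q => W q k) p := by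
    simp only [pderiv, Pi.add_apply, Pi.smul_apply, smul_eq_mul]
    rw [fderiv_fun_add hV' (hW'.const_mul s), fderiv_const_mul hW']
    simp
  rw [covDeriv, h]
  simp only [covDeriv, Pi.add_apply, Pi.smul_apply, smul_eq_mul, mul_add, Finset.mul_sum,
    Finset.sum_add_distrib]
  have : ∀ j, christoffel g k i j p * (s * W p j) = s * (christoffel g k i j p * W p j) :=
    fun j => by ring
  simp only [this]
  ring

/-- The pairing `⟨∇V, ∇W⟩ = g^{ij} g_{kl} (∇_i V)^k (∇_j W)^l`. -/
def covDerivInner (g : (ι → ℝ) → Matrix ι ι ℝ) (V W : (ι → ℝ) → ι → ℝ) (p : ι → ℝ) : ℝ :=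
  ∑ i, ∑ j, ∑ k, ∑ l, (g p)⁻¹ i j * g p k l * covDeriv g V i k p * covDeriv g W j l p

theorem covDerivInner_comm {g : (ι → ℝ) → Matrix ι ι ℝ} {p : ι → ℝ} (hsymm : (g p).IsSymm)
    (V W : (ι → ℝ) → ι → ℝ) : covDerivInner g V W p = covDerivInner g W V p := by
  have hinv : ∀ i j, (g p)⁻¹ i j = (g p)⁻¹ j i := fun i j => (hsymm.inv.apply i j).symm
  unfold covDerivInner
  rw [Finset.sum_comm]
  refine Finset.sum_congr rfl fun i _ => Finset.sum_congr rfl fun j _ => ?_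
  rw [Finset.sum_comm]
  refine Finset.sum_congr rfl fun k _ => Finset.sum_congr rfl fun l _ => ?_
  rw [hinv, ← hsymm.apply]
  ring

theorem covDerivNormSq_add_smul {g : (ι → ℝ) → Matrix ι ι ℝ} {p : ι → ℝ} (hsymm : (g p).IsSymm)
    {V W : (ι → ℝ) → ι → ℝ} (hV : DifferentiableAt ℝ V p) (hW : DifferentiableAt ℝ W p) (s : ℝ) :
    covDerivNormSq g (fun q => V q + s • W q) p
      = covDerivNormSq g V p + 2 * s * covDerivInner g V W p + s ^ 2 * covDerivNormSq g W p := by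
  have h1 : covDerivNormSq g (fun q => V q + s • W q) p = covDerivInner g V V p
      + s * covDerivInner g V W p + s * covDerivInner g W V p + s ^ 2 * covDerivInner g W W p := by
    simp only [covDerivNormSq, covDerivInner, covDeriv_add_smul g hV hW, Finset.mul_sum,
      ← Finset.sum_add_distrib]
    refine Finset.sum_congr rfl fun i _ => Finset.sum_congr rfl fun j _ =>
      Finset.sum_congr rfl fun k _ => Finset.sum_congr rfl fun l _ => ?_
    ring
  rw [h1, covDerivInner_comm hsymm W V]
  simp only [covDerivNormSq, covDerivInner]
  ring

theorem continuousOn_covDerivInner {M : Set (ι → ℝ)} (hM : IsOpen M) {g : (ι → ℝ) → Matrix ι ι ℝ}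
    (hg : ∀ i j, ContDiffOn ℝ ∞ (fun p => g p i j) M) (hdet : ∀ p ∈ M, (g p).det ≠ 0)
    {V W : (ι → ℝ) → ι → ℝ} (hV : ContDiffOn ℝ ∞ V M) (hW : ContDiffOn ℝ ∞ W M) :
    ContinuousOn (covDerivInner g V W) M :=
  continuousOn_finsetSum _ fun i _ => continuousOn_finsetSum _ fun j _ =>
    continuousOn_finsetSum _ fun k _ => continuousOn_finsetSum _ fun l _ =>
      ((((contDiffOn_inv hg hdet i j).mul (hg k l)).mul
        (contDiffOn_covDeriv hM hg hdet hV i k)).mul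
        (contDiffOn_covDeriv hM hg hdet hW j l)).continuousOn

theorem continuousOn_volumeDensity {M : Set (ι → ℝ)} {g : (ι → ℝ) → Matrix ι ι ℝ}
    (hg : ∀ i j, ContDiffOn ℝ ∞ (fun p => g p i j) M) :
    ContinuousOn (fun p => Real.sqrt (g p).det) M :=
  (contDiffOn_det hg).continuousOn.sqrt

/-- The energy is an exact quadratic polynomial in `s`, so its derivative at `0` is read off as a
coefficient, with no differentiation under the integral sign. -/
theorem hasDerivAt_energy {M : Set (ι → ℝ)} (hM : IsOpen M) {g : (ι → ℝ) → Matrix ι ι ℝ}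
    (hg : ∀ i j, ContDiffOn ℝ ∞ (fun p => g p i j) M) (hsymm : ∀ p ∈ M, (g p).IsSymm)
    (hdet : ∀ p ∈ M, (g p).det ≠ 0) {V W : (ι → ℝ) → ι → ℝ} (hV : ContDiffOn ℝ ∞ V M)
    (hW : ContDiffOn ℝ ∞ W M) {D : Set (ι → ℝ)} (hD : IsCompact D) (hDM : D ⊆ M) :
    HasDerivAt (fun s : ℝ => energy g D (fun p => V p + s • W p))
      (∫ p in D, covDerivInner g V W p * Real.sqrt (g p).det) 0 := by
  have hint : ∀ {V W : (ι → ℝ) → ι → ℝ}, ContDiffOn ℝ ∞ V M → ContDiffOn ℝ ∞ W M →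
      IntegrableOn (fun p => covDerivInner g V W p * Real.sqrt (g p).det) D := fun hV hW =>
    (((continuousOn_covDerivInner hM hg hdet hV hW).mul
      (continuousOn_volumeDensity hg)).mono hDM).integrableOn_compact hD
  have hdiff : ∀ {V : (ι → ℝ) → ι → ℝ}, ContDiffOn ℝ ∞ V M → ∀ p ∈ D, DifferentiableAt ℝ V p :=
    fun hV p hp => (hV.contDiffAt (hM.mem_nhds (hDM hp))).differentiableAt (by simp)
  have key : ∀ s : ℝ, energy g D (fun p => V p + s • W p) = energy g D V
      + s * (∫ p in D, covDerivInner g V W p * Real.sqrt (g p).det)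
      + s ^ 2 * (1 / 2 * ∫ p in D, covDerivInner g W W p * Real.sqrt (g p).det) := by
    intro s
    have : ∫ p in D, covDerivNormSq g (fun p => V p + s • W p) p * Real.sqrt (g p).det
        = ∫ p in D, (covDerivInner g V V p * Real.sqrt (g p).det
          + 2 * s * (covDerivInner g V W p * Real.sqrt (g p).det)
          + s ^ 2 * (covDerivInner g W W p * Real.sqrt (g p).det)) := by
      refine setIntegral_congr_fun hD.measurableSet fun p hp => ?_
      simp only [covDerivNormSq_add_smul (hsymm p (hDM hp)) (hdiff hV p hp) (hdiff hW p hp)]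
      simp only [covDerivNormSq, covDerivInner]
      ring
    have hVW := (hint hV hW).const_mul (2 * s)
    have hWW := (hint hW hW).const_mul (s ^ 2)
    simp only [energy, this]
    rw [integral_add (f := fun p => covDerivInner g V V p * Real.sqrt (g p).det
      + 2 * s * (covDerivInner g V W p * Real.sqrt (g p).det)) ((hint hV hV).add hVW) hWW,
      integral_add (hint hV hV) hVW,
      integral_const_mul, integral_const_mul]
    simp only [covDerivNormSq, covDerivInner]
    ring
  simp only [key]
  have h := ((hasDerivAt_id (0 : ℝ)).mul_const
    (∫ p in D, covDerivInner g V W p * Real.sqrt (g p).det)).const_add (energy g D V)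
  have h' := (((hasDerivAt_id (0 : ℝ)).pow 2).mul_const
    (1 / 2 * ∫ p in D, covDerivInner g W W p * Real.sqrt (g p).det))
  simpa using h.fun_add h'

/-- The density `√(det g) g^{ij} g_{kl} (∇_j V)^l`. -/
def momentum (g : (ι → ℝ) → Matrix ι ι ℝ) (V : (ι → ℝ) → ι → ℝ) (i k : ι) (p : ι → ℝ) : ℝ :=
  Real.sqrt (g p).det * ∑ j, ∑ l, (g p)⁻¹ j i * g p l k * covDeriv g V j l p

/-- The `l`-th covariant component of the rough Laplacian `∇*∇V`, times `√(det g)`. -/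
def roughLaplacian (g : (ι → ℝ) → Matrix ι ι ℝ) (V : (ι → ℝ) → ι → ℝ) (l : ι) (p : ι → ℝ) : ℝ :=
  (∑ i, ∑ k, momentum g V i k p * christoffel g k i l p) - ∑ i, pderiv i (momentum g V i l) p

theorem contDiffOn_momentum {M : Set (ι → ℝ)} (hM : IsOpen M) {g : (ι → ℝ) → Matrix ι ι ℝ}
    (hg : ∀ i j, ContDiffOn ℝ ∞ (fun p => g p i j) M) (hdet : ∀ p ∈ M, (g p).det ≠ 0)
    {V : (ι → ℝ) → ι → ℝ} (hV : ContDiffOn ℝ ∞ V M) (i k : ι) :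
    ContDiffOn ℝ ∞ (momentum g V i k) M :=
  ((contDiffOn_det hg).sqrt hdet).mul (ContDiffOn.sum fun j _ => ContDiffOn.sum fun l _ =>
    ((contDiffOn_inv hg hdet j i).mul (hg l k)).mul (contDiffOn_covDeriv hM hg hdet hV j l))

theorem contDiffOn_roughLaplacian {M : Set (ι → ℝ)} (hM : IsOpen M)
    {g : (ι → ℝ) → Matrix ι ι ℝ} (hg : ∀ i j, ContDiffOn ℝ ∞ (fun p => g p i j) M)
    (hdet : ∀ p ∈ M, (g p).det ≠ 0) {V : (ι → ℝ) → ι → ℝ} (hV : ContDiffOn ℝ ∞ V M) (l : ι) :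
    ContDiffOn ℝ ∞ (roughLaplacian g V l) M :=
  (ContDiffOn.sum fun i _ => ContDiffOn.sum fun k _ =>
    (contDiffOn_momentum hM hg hdet hV i k).mul (contDiffOn_christoffel hM hg hdet k i l)).sub
  (ContDiffOn.sum fun i _ => contDiffOn_pderiv hM i (contDiffOn_momentum hM hg hdet hV i l))

/-- Isolates the coefficient of each `(∇_i W)^k`, so that integration by parts can be done one
coordinate at a time. -/
theorem covDerivInner_mul_eq_sum_momentum (g : (ι → ℝ) → Matrix ι ι ℝ) (V W : (ι → ℝ) → ι → ℝ)
    (p : ι → ℝ) : covDerivInner g V W p * Real.sqrt (g p).det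
      = ∑ i, ∑ k, momentum g V i k p * covDeriv g W i k p := by
  simp only [covDerivInner, momentum, Finset.mul_sum, Finset.sum_mul]
  rw [Finset.sum_comm]
  refine Finset.sum_congr rfl fun i _ => ?_
  have : ∀ j, ∑ k, ∑ l, (g p)⁻¹ j i * g p k l * covDeriv g V j k p * covDeriv g W i l p
        * Real.sqrt (g p).det
      = ∑ k, ∑ l, Real.sqrt (g p).det * ((g p)⁻¹ j i * g p l k * covDeriv g V j l p)
        * covDeriv g W i k p := fun j => by
    rw [Finset.sum_comm]
    refine Finset.sum_congr rfl fun k _ => Finset.sum_congr rfl fun l _ => ?_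
    ring
  simp only [this]
  exact Finset.sum_comm

theorem integral_mul_pderiv {M : Set (ι → ℝ)} (hM : IsOpen M) {u w : (ι → ℝ) → ℝ}
    (hu : ContDiffOn ℝ ∞ u M) (hw : ContDiff ℝ ∞ w) (hwc : HasCompactSupport w)
    (hwM : tsupport w ⊆ M) (i : ι) :
    ∫ p, u p * pderiv i w p = -∫ p, pderiv i u p * w p := by
  refine integral_mul_fderiv_eq_neg_fderiv_mul_of_integrable ?_ ?_ ?_ ?_ ?_
  · exact integrable_mul_of_tsupport_subset hM (contDiffOn_pderiv hM i hu).continuousOn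
      hw.continuous hwc hwM
  · exact integrable_mul_of_tsupport_subset hM hu.continuousOn
      (contDiff_pderiv i hw).continuous (hwc.fderiv_apply ℝ _)
      ((tsupport_pderiv_subset i w).trans hwM)
  · exact integrable_mul_of_tsupport_subset hM hu.continuousOn hw.continuous hwc hwM
  · exact fun p hp => (hu.contDiffAt (hM.mem_nhds (hwM hp))).differentiableAt (by simp)
  · exact fun p _ => hw.contDiffAt.differentiableAt (by simp)

/-- In `(∇_i W)^k = ∂_i W^k + Γ^k_{il} W^l` only the first term is integrated by parts; the second
is already linear in the values of `W`. Collecting the coefficient of `W^l` gives `roughLaplacian`.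
-/
theorem integral_covDerivInner {M : Set (ι → ℝ)} (hM : IsOpen M) {g : (ι → ℝ) → Matrix ι ι ℝ}
    (hg : ∀ i j, ContDiffOn ℝ ∞ (fun p => g p i j) M) (hdet : ∀ p ∈ M, (g p).det ≠ 0)
    {V W : (ι → ℝ) → ι → ℝ} (hV : ContDiffOn ℝ ∞ V M) (hW : ContDiff ℝ ∞ W)
    {D : Set (ι → ℝ)} (hD : IsCompact D) (hDM : D ⊆ M) (hWD : tsupport W ⊆ D) :
    ∫ p in D, covDerivInner g V W p * Real.sqrt (g p).det
      = ∑ l, ∫ p, roughLaplacian g V l p * W p l := by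
  have hWc : HasCompactSupport W := hD.of_isClosed_subset (isClosed_tsupport W) hWD
  have hwl : ∀ l, ContDiff ℝ ∞ (fun p => W p l) := fun l => contDiff_pi.1 hW l
  have hwM : ∀ l, tsupport (fun p => W p l) ⊆ M := fun l =>
    (tsupport_apply_subset W l).trans (hWD.trans hDM)
  have hwc : ∀ l, HasCompactSupport (fun p => W p l) := fun l =>
    hWc.of_isClosed_subset (isClosed_tsupport _) (tsupport_apply_subset W l)
  have hmom := contDiffOn_momentum hM hg hdet hV
  have hchr := contDiffOn_christoffel hM hg hdet
  have hI1 : ∀ i k, Integrable (fun p => momentum g V i k p * pderiv i (fun q => W q k) p) :=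
    fun i k => integrable_mul_of_tsupport_subset hM (hmom i k).continuousOn
      (contDiff_pderiv i (hwl k)).continuous ((hwc k).fderiv_apply ℝ _)
      ((tsupport_pderiv_subset i _).trans (hwM k))
  have hI2 : ∀ i k l, Integrable (fun p => momentum g V i k p * christoffel g k i l p * W p l) :=
    fun i k l => integrable_mul_of_tsupport_subset hM
      ((hmom i k).mul (hchr k i l)).continuousOn (hwl l).continuous (hwc l) (hwM l)
  have hI12 : ∀ i k, Integrable (fun p => momentum g V i k p * pderiv i (fun q => W q k) p
      + ∑ l, momentum g V i k p * christoffel g k i l p * W p l) :=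
    fun i k => (hI1 i k).add (integrable_finsetSum _ fun l _ => hI2 i k l)
  have hI3 : ∀ i l, Integrable (fun p => pderiv i (momentum g V i l) p * W p l) :=
    fun i l => integrable_mul_of_tsupport_subset hM
      (contDiffOn_pderiv hM i (hmom i l)).continuousOn (hwl l).continuous (hwc l) (hwM l)
  -- Extending the integral from `D` to the whole space avoids any boundary term, whatever the shape
  -- of `D`.
  have hzero : ∀ p ∉ D, ∑ i, ∑ k, momentum g V i k p * covDeriv g W i k p = 0 := by
    intro p hp
    have h0 : ∀ l, W p l = 0 := fun l =>
      congrFun (image_eq_zero_of_notMem_tsupport fun h => hp (hWD h)) l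
    have h1 : ∀ i l, pderiv i (fun q => W q l) p = 0 := fun i l =>
      image_eq_zero_of_notMem_tsupport fun h =>
        hp (hWD (tsupport_apply_subset W l (tsupport_pderiv_subset i _ h)))
    simp [covDeriv, h0, h1]
  simp only [covDerivInner_mul_eq_sum_momentum]
  rw [setIntegral_eq_integral_of_forall_compl_eq_zero hzero]
  simp only [covDeriv, mul_add, Finset.mul_sum, ← mul_assoc]
  rw [integral_finsetSum _ fun i _ => integrable_finsetSum _ fun k _ =>
    hI12 i k]
  have e1 : ∀ i, ∫ p, ∑ k, (momentum g V i k p * pderiv i (fun q => W q k) p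
      + ∑ l, momentum g V i k p * christoffel g k i l p * W p l)
      = ∑ k, (-(∫ p, pderiv i (momentum g V i k) p * W p k)
        + ∑ l, ∫ p, momentum g V i k p * christoffel g k i l p * W p l) := by
    intro i
    rw [integral_finsetSum _ fun k _ =>
      hI12 i k]
    refine Finset.sum_congr rfl fun k _ => ?_
    rw [integral_add (hI1 i k) (integrable_finsetSum _ fun l _ => hI2 i k l),
      integral_mul_pderiv hM (hmom i k) (hwl k) (hwc k) (hwM k) i,
      integral_finsetSum _ fun l _ => hI2 i k l]
  have e2 : ∀ l, ∫ p, roughLaplacian g V l p * W p l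
      = (∑ i, ∑ k, ∫ p, momentum g V i k p * christoffel g k i l p * W p l)
        - ∑ i, ∫ p, pderiv i (momentum g V i l) p * W p l := by
    intro l
    simp only [roughLaplacian, sub_mul, Finset.sum_mul]
    rw [integral_sub (integrable_finsetSum _ fun i _ => integrable_finsetSum _ fun k _ =>
      hI2 i k l) (integrable_finsetSum _ fun i _ => hI3 i l),
      integral_finsetSum _ fun i _ => integrable_finsetSum _ fun k _ => hI2 i k l,
      integral_finsetSum _ fun i _ => hI3 i l]
    congr 1
    exact Finset.sum_congr rfl fun i _ => integral_finsetSum _ fun k _ => hI2 i k l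
  simp only [e1, e2]
  simp only [Finset.sum_add_distrib, Finset.sum_sub_distrib, Finset.sum_neg_distrib]
  have s1 : ∑ i, ∑ k, ∫ p, pderiv i (momentum g V i k) p * W p k
      = ∑ k, ∑ i, ∫ p, pderiv i (momentum g V i k) p * W p k := Finset.sum_comm
  have s2 : ∑ i, ∑ k, ∑ l, ∫ p, momentum g V i k p * christoffel g k i l p * W p l
      = ∑ l, ∑ i, ∑ k, ∫ p, momentum g V i k p * christoffel g k i l p * W p l := by
    rw [Finset.sum_comm (s := (Finset.univ : Finset ι)) (t := Finset.univ)
      (f := fun l i => ∑ k, ∫ p, momentum g V i k p * christoffel g k i l p * W p l)]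
    exact Finset.sum_congr rfl fun i _ => Finset.sum_comm
  rw [s1, s2]
  ring

/-- A smooth vector field is harmonic if and only if its rough Laplacian vanishes. -/
theorem isHarmonicVectorField_iff {M : Set (ι → ℝ)} (hM : IsOpen M) {g : (ι → ℝ) → Matrix ι ι ℝ}
    (hg : ∀ i j, ContDiffOn ℝ ∞ (fun p => g p i j) M) (hsymm : ∀ p ∈ M, (g p).IsSymm)
    (hdet : ∀ p ∈ M, (g p).det ≠ 0) {V : (ι → ℝ) → ι → ℝ} (hV : ContDiffOn ℝ ∞ V M) :
    IsHarmonicVectorField g M V ↔ ∀ l, ∀ p ∈ M, roughLaplacian g V l p = 0 := by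
  constructor
  · rintro ⟨-, h⟩ l
    refine eqOn_zero_of_integral_mul_eq_zero hM
      (contDiffOn_roughLaplacian hM hg hdet hV l).continuousOn fun w hw hwc hwM => ?_
    -- A variation in the `l`-th slot alone isolates one component; the compact set is the support
    -- of `w` itself.
    have hW : ContDiff ℝ ∞ (fun p => Pi.single l (w p) : (ι → ℝ) → ι → ℝ) :=
      (ContinuousLinearMap.single ℝ (fun _ : ι => ℝ) l).contDiff.comp hw
    have hWD : tsupport (fun p => Pi.single l (w p) : (ι → ℝ) → ι → ℝ) ⊆ tsupport w :=
      closure_mono fun p hp h0 => hp (by simp [h0])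
    have h1 := (hasDerivAt_energy hM hg hsymm hdet hV hW.contDiffOn hwc hwM).unique
      (h _ _ hwc hwM hW hWD)
    rw [integral_covDerivInner hM hg hdet hV hW hwc hwM hWD, Finset.sum_eq_single l] at h1
    · simpa using h1
    · intro k _ hk
      simp [hk]
    · simp
  · refine fun h => ⟨hV, fun D W hD hDM hW hWD => ?_⟩
    convert hasDerivAt_energy hM hg hsymm hdet hV hW.contDiffOn hD hDM using 1
    rw [integral_covDerivInner hM hg hdet hV hW hD hDM hWD]
    refine (Finset.sum_eq_zero fun l _ => integral_eq_zero_of_ae (.of_forall fun p => ?_)).symm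
    by_cases hp : p ∈ M
    · simp [h l p hp]
    · have : W p = 0 := image_eq_zero_of_notMem_tsupport fun hp' => hp (hDM (hWD hp'))
      simp [this]

end Chart

/-! ### Euler's equation `y² u'' = k u` on the half-line. -/

/-- A function with second derivative `λ u / y²` on `(0, ∞)`, with its derivative. -/
def IsEulerSolution (k : ℝ) (u u' : ℝ → ℝ) : Prop :=
  ∀ y : ℝ, 0 < y → HasDerivAt u (u' y) y ∧ HasDerivAt u' (k * u y / y ^ 2) y

theorem isEulerSolution_deriv {k : ℝ} {u : ℝ → ℝ} (hu : ContDiffOn ℝ ∞ u (Set.Ioi 0))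
    (h : ∀ y : ℝ, 0 < y → y ^ 2 * deriv (deriv u) y = k * u y) :
    IsEulerSolution k u (deriv u) := by
  intro y hy
  have hd : ContDiffOn ℝ ∞ (deriv u) (Set.Ioi 0) := hu.deriv_of_isOpen isOpen_Ioi (by simp)
  have hm := Ioi_mem_nhds hy
  refine ⟨((hu.contDiffAt hm).differentiableAt (by simp)).hasDerivAt, ?_⟩
  rw [show k * u y / y ^ 2 = deriv (deriv u) y by rw [← h y hy]; field_simp]
  exact ((hd.contDiffAt hm).differentiableAt (by simp)).hasDerivAt

theorem IsEulerSolution.mul_deriv_deriv {k : ℝ} {v v' u : ℝ → ℝ} (h : IsEulerSolution k v v')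
    (huv : ∀ y : ℝ, 0 < y → u y = v y) {y : ℝ} (hy : 0 < y) :
    y ^ 2 * deriv (deriv u) y = k * u y := by
  have e1 : ∀ y : ℝ, 0 < y → deriv u y = v' y := fun y hy => by
    rw [Filter.EventuallyEq.deriv_eq (f := v) (Filter.mem_of_superset (Ioi_mem_nhds hy) huv)]
    exact (h y hy).1.deriv
  rw [Filter.EventuallyEq.deriv_eq (f := v') (Filter.mem_of_superset (Ioi_mem_nhds hy) e1),
    (h y hy).2.deriv, huv y hy]
  field_simp

theorem IsEulerSolution.linearCombination {k : ℝ} {v v' w w' : ℝ → ℝ}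
    (hv : IsEulerSolution k v v') (hw : IsEulerSolution k w w') (a b : ℝ) :
    IsEulerSolution k (fun y => a * v y + b * w y) (fun y => a * v' y + b * w' y) := by
  refine fun y hy => ⟨((hv y hy).1.const_mul a).add ((hw y hy).1.const_mul b), ?_⟩
  exact (((hv y hy).2.const_mul a).add ((hw y hy).2.const_mul b)).congr_deriv (by ring)

/-- The equation has no first-order term, so the derivative `v w'' - v'' w` of the Wronskian
vanishes. -/
theorem IsEulerSolution.wronskian_eq {k : ℝ} {v v' w w' : ℝ → ℝ}
    (hv : IsEulerSolution k v v') (hw : IsEulerSolution k w w') {y : ℝ} (hy : 0 < y) :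
    v y * w' y - v' y * w y = v 1 * w' 1 - v' 1 * w 1 := by
  have hd : ∀ z ∈ Set.Ioi (0 : ℝ), HasDerivAt (fun z => v z * w' z - v' z * w z) 0 z := by
    intro z hz
    exact (((hv z hz).1.mul (hw z hz).2).sub ((hv z hz).2.mul (hw z hz).1)).congr_deriv (by ring)
  exact (convex_Ioi (0 : ℝ)).is_const_of_fderivWithin_eq_zero (𝕜 := ℝ)
    (fun z hz => (hd z hz).differentiableAt.differentiableWithinAt)
    (fun z hz => by
      rw [fderivWithin_of_isOpen isOpen_Ioi hz]
      ext
      simpa using (hd z hz).deriv) hy (Set.mem_Ioi.2 one_pos)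

/-- Two solutions with nonzero Wronskian span the solutions of Euler's equation. -/
theorem euler_iff_exists_linearCombination {k : ℝ} {v v' w w' : ℝ → ℝ}
    (hv : IsEulerSolution k v v') (hw : IsEulerSolution k w w')
    (hvw : v 1 * w' 1 - v' 1 * w 1 ≠ 0) {u : ℝ → ℝ} (hu : ContDiffOn ℝ ∞ u (Set.Ioi 0)) :
    (∀ y : ℝ, 0 < y → y ^ 2 * deriv (deriv u) y = k * u y) ↔
      ∃ κ₁ κ₂ : ℝ, ∀ y : ℝ, 0 < y → u y = κ₁ * v y + κ₂ * w y := by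
  constructor
  · intro h
    have hu' := isEulerSolution_deriv hu h
    -- Cramer's rule at `y = 1`. All three Wronskians involved are constant, so the same
    -- coefficients work at every `y`.
    refine ⟨(u 1 * w' 1 - deriv u 1 * w 1) / (v 1 * w' 1 - v' 1 * w 1),
      (v 1 * deriv u 1 - v' 1 * u 1) / (v 1 * w' 1 - v' 1 * w 1), fun y hy => ?_⟩
    have h1 := hu'.wronskian_eq hw hy
    have h2 := hv.wronskian_eq hu' hy
    have h3 := hv.wronskian_eq hw hy
    rw [div_mul_eq_mul_div, div_mul_eq_mul_div, ← add_div, eq_div_iff hvw, ← h1, ← h2, ← h3]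
    ring
  · rintro ⟨κ₁, κ₂, h⟩ y hy
    exact (hv.linearCombination hw κ₁ κ₂).mul_deriv_deriv h hy

/-- The hypothesis is the indicial equation. -/
theorem isEulerSolution_rpow {k r : ℝ} (hr : r * (r - 1) = k) :
    IsEulerSolution k (fun y => y ^ r) (fun y => r * y ^ (r - 1)) := by
  intro y hy
  refine ⟨Real.hasDerivAt_rpow_const (Or.inl hy.ne'), ?_⟩
  refine ((Real.hasDerivAt_rpow_const (p := r - 1) (Or.inl hy.ne')).const_mul r).congr_deriv ?_
  rw [← hr, Real.rpow_sub_one hy.ne', Real.rpow_sub_one hy.ne']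
  field_simp

/-- The substitution `u = y^{1/2} h(log y)` turns Euler's equation into the constant-coefficient
equation `h'' = (k + 1/4) h`. -/
theorem isEulerSolution_rpow_mul {k : ℝ} {h h' h'' : ℝ → ℝ}
    (hh : ∀ x, HasDerivAt h (h' x) x) (hh' : ∀ x, HasDerivAt h' (h'' x) x)
    (hk : ∀ x, h'' x = (k + 1 / 4) * h x) :
    IsEulerSolution k (fun y => y ^ (1 / 2 : ℝ) * h (Real.log y))
      (fun y => y ^ (-1 / 2 : ℝ) * (1 / 2 * h (Real.log y) + h' (Real.log y))) := by
  intro y hy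
  have e1 : y ^ (1 / 2 : ℝ) = y ^ (-1 / 2 : ℝ) * y := by
    rw [← Real.rpow_add_one hy.ne']; norm_num
  have e2 : y ^ (-1 / 2 - 1 : ℝ) = y ^ (-1 / 2 : ℝ) / y := Real.rpow_sub_one hy.ne' _
  have e3 : y ^ (1 / 2 - 1 : ℝ) = y ^ (-1 / 2 : ℝ) := by norm_num
  have hl := Real.hasDerivAt_log hy.ne'
  have d0 := (hh (Real.log y)).comp y hl
  have d1 := (hh' (Real.log y)).comp y hl
  constructor
  · refine ((Real.hasDerivAt_rpow_const (p := 1 / 2) (Or.inl hy.ne')).mul d0).congr_deriv ?_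
    rw [e3, e1]
    simp only [Function.comp]
    field_simp
  · refine ((Real.hasDerivAt_rpow_const (p := -1 / 2) (Or.inl hy.ne')).mul
      ((d0.const_mul (1 / 2)).add d1)).congr_deriv ?_
    simp only [e2, e1, Function.comp, Pi.add_apply, hk]
    field_simp
    ring

/-- The indicial roots coincide at `1/2`, and `h'' = 0` has the solutions `1` and `x`. -/
theorem euler_iff_of_discriminant_zero {u : ℝ → ℝ} (hu : ContDiffOn ℝ ∞ u (Set.Ioi 0)) {k : ℝ}
    (hk : 1 + 4 * k = 0) :
    (∀ y : ℝ, 0 < y → y ^ 2 * deriv (deriv u) y = k * u y) ↔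
      ∃ κ₁ κ₂ : ℝ, ∀ y : ℝ, 0 < y → u y = y ^ (1 / 2 : ℝ) * (κ₁ + κ₂ * Real.log y) := by
  have hv := isEulerSolution_rpow_mul (k := k) (h := fun _ => 1) (h' := fun _ => 0)
    (h'' := fun _ => 0) (fun x => hasDerivAt_const x 1) (fun x => hasDerivAt_const x 0)
    (fun x => by linarith)
  have hw := isEulerSolution_rpow_mul (k := k) (h := fun x => x) (h' := fun _ => 1)
    (h'' := fun _ => 0) (fun x => hasDerivAt_id x) (fun x => hasDerivAt_const x 1)
    (fun x => by rw [show k + 1 / 4 = 0 by linarith, zero_mul])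
  rw [euler_iff_exists_linearCombination hv hw (by simp) hu]
  refine exists_congr fun a => exists_congr fun b => forall₂_congr fun y _ => ?_
  rw [show y ^ (1 / 2 : ℝ) * (a + b * Real.log y)
    = a * (y ^ (1 / 2 : ℝ) * 1) + b * (y ^ (1 / 2 : ℝ) * Real.log y) by ring]

/-- The exponents are the two distinct indicial roots; the Wronskian at `1` is minus the square root
of the discriminant. -/
theorem euler_iff_of_discriminant_pos {u : ℝ → ℝ} (hu : ContDiffOn ℝ ∞ u (Set.Ioi 0)) {k : ℝ}
    (hk : 0 < 1 + 4 * k) :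
    (∀ y : ℝ, 0 < y → y ^ 2 * deriv (deriv u) y = k * u y) ↔
      ∃ κ₁ κ₂ : ℝ, ∀ y : ℝ, 0 < y →
        u y = κ₁ * y ^ (1 / 2 + 1 / 2 * Real.sqrt (1 + 4 * k))
          + κ₂ * y ^ (1 / 2 - 1 / 2 * Real.sqrt (1 + 4 * k)) := by
  have hs := Real.sq_sqrt hk.le
  have hs0 := Real.sqrt_pos.2 hk
  refine euler_iff_exists_linearCombination (isEulerSolution_rpow ?_) (isEulerSolution_rpow ?_)
    ?_ hu
  · linarith
  · linarith
  · simp only [Real.one_rpow]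
    intro h
    linarith

theorem euler_iff_of_discriminant_neg {u : ℝ → ℝ} (hu : ContDiffOn ℝ ∞ u (Set.Ioi 0)) {k : ℝ}
    (hk : 1 + 4 * k < 0) :
    (∀ y : ℝ, 0 < y → y ^ 2 * deriv (deriv u) y = k * u y) ↔
      ∃ κ₁ κ₂ : ℝ, ∀ y : ℝ, 0 < y → u y = y ^ (1 / 2 : ℝ) *
        (κ₁ * Real.cos (1 / 2 * Real.sqrt (-(1 + 4 * k)) * Real.log y)
          + κ₂ * Real.sin (1 / 2 * Real.sqrt (-(1 + 4 * k)) * Real.log y)) := by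
  have hs := Real.sq_sqrt (neg_pos.2 hk).le
  have hs0 := Real.sqrt_pos.2 (neg_pos.2 hk)
  set m := Real.sqrt (-(1 + 4 * k))
  have hm : ∀ x, HasDerivAt (fun x : ℝ => 1 / 2 * m * x) (1 / 2 * m) x := fun x => by
    simpa using (hasDerivAt_id x).const_mul (1 / 2 * m)
  have hkm : k + 1 / 4 = -(1 / 2 * m) * (1 / 2 * m) := by linarith
  have hv := isEulerSolution_rpow_mul (k := k)
    (fun x => (hm x).cos) (fun x => ((hm x).sin.neg.mul_const (1 / 2 * m)))
    (fun x => by rw [hkm]; ring)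
  have hw := isEulerSolution_rpow_mul (k := k)
    (fun x => (hm x).sin) (fun x => ((hm x).cos.mul_const (1 / 2 * m)))
    (fun x => by rw [hkm]; ring)
  rw [euler_iff_exists_linearCombination hv hw (by simp [hs0.ne']) hu]
  refine exists_congr fun a => exists_congr fun b => forall₂_congr fun y _ => ?_
  rw [mul_add]
  ring_nf

/-- Here `k = -ε/α` and the discriminant is `1 - 4ε/α`. The three clauses of `ExplicitC` have
mutually exclusive premises, so in each case two of them are vacuous. -/
theorem explicitC_iff {α ε : ℝ} (hα : 0 < α) {c : ℝ → ℝ} (hc : ContDiffOn ℝ ∞ c (Set.Ioi 0)) :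
    (∀ y : ℝ, 0 < y → α * y ^ 2 * deriv (deriv c) y = -ε * c y) ↔ ExplicitC α ε c := by
  have e : (∀ y : ℝ, 0 < y → α * y ^ 2 * deriv (deriv c) y = -ε * c y) ↔
      ∀ y : ℝ, 0 < y → y ^ 2 * deriv (deriv c) y = (-ε / α) * c y := by
    refine forall₂_congr fun y _ => ?_
    field_simp
  have e1 : 1 - 4 * ε / α = 1 + 4 * (-ε / α) := by ring
  have e2 : 4 * ε / α - 1 = -(1 + 4 * (-ε / α)) := by ring
  have e3 : 1 + 4 * (-ε / α) = (α - 4 * ε) / α := by field_simp; ring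
  rw [e, ExplicitC, e1, e2]
  rcases lt_trichotomy (4 * ε) α with h | h | h
  · rw [euler_iff_of_discriminant_pos hc (by rw [e3]; exact div_pos (by linarith) hα)]
    simp [h, h.ne', h.not_gt]
  · rw [euler_iff_of_discriminant_zero hc (by rw [e3, h]; simp)]
    simp [h]
  · rw [euler_iff_of_discriminant_neg hc (by rw [e3]; exact div_neg_of_neg_of_pos (by linarith) hα)]
    simp [h, h.ne, h.not_gt]

/-- As for `c`, with `k = 1 - ε/α` and discriminant `5 - 4ε/α`. -/
theorem explicitB_iff {α ε : ℝ} (hα : 0 < α) {b : ℝ → ℝ} (hb : ContDiffOn ℝ ∞ b (Set.Ioi 0)) :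
    (∀ y : ℝ, 0 < y → α * y ^ 2 * deriv (deriv b) y = (α - ε) * b y) ↔ ExplicitB α ε b := by
  have e : (∀ y : ℝ, 0 < y → α * y ^ 2 * deriv (deriv b) y = (α - ε) * b y) ↔
      ∀ y : ℝ, 0 < y → y ^ 2 * deriv (deriv b) y = ((α - ε) / α) * b y := by
    refine forall₂_congr fun y _ => ?_
    field_simp
  have e1 : 5 - 4 * ε / α = 1 + 4 * ((α - ε) / α) := by field_simp; ring
  have e2 : 4 * ε / α - 5 = -(1 + 4 * ((α - ε) / α)) := by field_simp; ring
  have e3 : 1 + 4 * ((α - ε) / α) = (5 * α - 4 * ε) / α := by field_simp; ring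
  rw [e, ExplicitB, e1, e2]
  rcases lt_trichotomy (4 * ε) (5 * α) with h | h | h
  · rw [euler_iff_of_discriminant_pos hb (by rw [e3]; exact div_pos (by linarith) hα)]
    simp [h, h.ne, h.not_gt]
  · rw [euler_iff_of_discriminant_zero hb (by rw [e3, h]; simp)]
    simp [h]
  · rw [euler_iff_of_discriminant_neg hb (by rw [e3]; exact div_neg_of_neg_of_pos (by linarith) hα)]
    simp [h, h.ne', h.not_gt]

/-! ### Metric and connection of the warped product. -/

/-- Reduces a partial derivative to a one-variable one. Agreement near `p i` is enough, which
matters for formulas valid only on `totalSet`. -/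
theorem pderiv_eq_of_hasDerivAt {ι : Type} [Fintype ι] [DecidableEq ι] {i : ι}
    {h : (ι → ℝ) → ℝ} {p : ι → ℝ} {u : ℝ → ℝ} {d : ℝ} (hd : DifferentiableAt ℝ h p)
    (hu : ∀ᶠ s in nhds (p i), h (Function.update p i s) = u s) (h' : HasDerivAt u d (p i)) :
    pderiv i h p = d := by
  have h1 : HasFDerivAt h (fderiv ℝ h p) (Function.update p i (p i)) := by
    simpa using hd.hasFDerivAt
  have h2 := h1.comp_hasDerivAt (p i) (hasDerivAt_update p i (p i))
  exact h2.unique (h'.congr_of_eventuallyEq hu)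

theorem index_cases (i : Unit ⊕ Fin 3) :
    i = Sum.inl () ∨ i = Sum.inr 0 ∨ i = Sum.inr 1 ∨ i = Sum.inr 2 := by
  revert i; decide

/-- The diagonal entries of `totalMetric`, for the values `F` of `f` and `y` of the coordinate. -/
def metricEntry (α F y : ℝ) : Unit ⊕ Fin 3 → ℝ :=
  Sum.elim (fun _ => 1) ![F ^ 2 / (α * y ^ 2), F ^ 2 / (α * y ^ 2), F ^ 2]

/-- The derivatives of `metricEntry`, the first index being the direction. -/
def metricEntryDeriv (α F F' y : ℝ) : Unit ⊕ Fin 3 → Unit ⊕ Fin 3 → ℝ :=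
  Sum.elim (fun _ => Sum.elim (fun _ => 0)
      ![2 * F * F' / (α * y ^ 2), 2 * F * F' / (α * y ^ 2), 2 * F * F'])
    ![0, Sum.elim (fun _ => 0)
      ![-(2 * F ^ 2) / (α * y ^ 3), -(2 * F ^ 2) / (α * y ^ 3), 0], 0]

theorem totalMetric_eq (α : ℝ) (f : ℝ → ℝ) (p : Unit ⊕ Fin 3 → ℝ) :
    totalMetric α f p
      = Matrix.diagonal (metricEntry α (f (p (Sum.inl ()))) (p (Sum.inr 1))) := by
  ext i j
  rcases index_cases i with rfl | rfl | rfl | rfl <;>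
  rcases index_cases j with rfl | rfl | rfl | rfl <;>
  simp [totalMetric, warpedMetric, lineMetric, fibreMetric, metricEntry] <;>
  ring

section TotalSpace

variable {α : ℝ} {I : Set ℝ} {f φ b c : ℝ → ℝ}

theorem isOpen_totalSet (hI : IsOpen I) : IsOpen (totalSet I) :=
  (hI.preimage (continuous_apply (Sum.inl ()))).inter
    (isOpen_Ioi.preimage (continuous_apply (Sum.inr 1)))

theorem contDiffOn_comp_time (hf : ContDiffOn ℝ ∞ f I) :
    ContDiffOn ℝ ∞ (fun p : Unit ⊕ Fin 3 → ℝ => f (p (Sum.inl ()))) (totalSet I) :=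
  hf.comp (contDiff_apply ℝ ℝ _).contDiffOn fun _ hp => hp.1

theorem contDiffOn_comp_height (hb : ContDiffOn ℝ ∞ b (Set.Ioi 0)) :
    ContDiffOn ℝ ∞ (fun p : Unit ⊕ Fin 3 → ℝ => b (p (Sum.inr 1))) (totalSet I) :=
  hb.comp (contDiff_apply ℝ ℝ _).contDiffOn fun _ hp => hp.2

theorem metricEntry_pos (hα : 0 < α) {F y : ℝ} (hF : 0 < F) (hy : 0 < y) (i : Unit ⊕ Fin 3) :
    0 < metricEntry α F y i := by
  rcases index_cases i with rfl | rfl | rfl | rfl <;> simp [metricEntry] <;> positivity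

theorem contDiffOn_totalMetric (hα : 0 < α) (hf : ContDiffOn ℝ ∞ f I) (i j : Unit ⊕ Fin 3) :
    ContDiffOn ℝ ∞ (fun p => totalMetric α f p i j) (totalSet I) := by
  have h1 := (contDiffOn_comp_time hf).pow 2
  have h2 : ContDiffOn ℝ ∞ (fun p : Unit ⊕ Fin 3 → ℝ => α * p (Sum.inr 1) ^ 2) (totalSet I) :=
    contDiffOn_const.mul ((contDiff_apply ℝ ℝ _).contDiffOn.pow 2)
  have h3 := h1.div h2 fun p hp => (mul_pos hα (pow_pos hp.2 2)).ne'
  simp only [totalMetric_eq, Matrix.diagonal_apply]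
  split_ifs
  · rcases index_cases i with rfl | rfl | rfl | rfl
    · exact contDiffOn_const
    · exact h3
    · exact h3
    · exact h1
  · exact contDiffOn_const

theorem isSymm_totalMetric (α : ℝ) (f : ℝ → ℝ) (p : Unit ⊕ Fin 3 → ℝ) :
    (totalMetric α f p).IsSymm := by
  rw [totalMetric_eq]; exact Matrix.isSymm_diagonal _

theorem det_totalMetric (α : ℝ) (f : ℝ → ℝ) (p : Unit ⊕ Fin 3 → ℝ) :
    (totalMetric α f p).det = (f (p (Sum.inl ())) ^ 3 / (α * p (Sum.inr 1) ^ 2)) ^ 2 := by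
  rw [totalMetric_eq, Matrix.det_diagonal]
  simp [metricEntry, Fin.prod_univ_three]
  ring

theorem volumeDensity_totalMetric (hα : 0 < α) (hfpos : ∀ t ∈ I, 0 < f t)
    {p : Unit ⊕ Fin 3 → ℝ} (hp : p ∈ totalSet I) :
    Real.sqrt (totalMetric α f p).det = f (p (Sum.inl ())) ^ 3 / (α * p (Sum.inr 1) ^ 2) := by
  rw [det_totalMetric]
  have hF := hfpos _ hp.1
  exact Real.sqrt_sq (by positivity)

theorem det_totalMetric_ne_zero (hα : 0 < α) (hfpos : ∀ t ∈ I, 0 < f t)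
    {p : Unit ⊕ Fin 3 → ℝ} (hp : p ∈ totalSet I) : (totalMetric α f p).det ≠ 0 := by
  rw [det_totalMetric]
  have hF : 0 < f (p (Sum.inl ())) := hfpos _ hp.1
  have hy : 0 < p (Sum.inr 1) := hp.2
  positivity

theorem inv_totalMetric (hα : 0 < α) (hfpos : ∀ t ∈ I, 0 < f t)
    {p : Unit ⊕ Fin 3 → ℝ} (hp : p ∈ totalSet I) :
    (totalMetric α f p)⁻¹
      = Matrix.diagonal (fun i => (metricEntry α (f (p (Sum.inl ()))) (p (Sum.inr 1)) i)⁻¹) := by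
  refine Matrix.inv_eq_left_inv ?_
  rw [totalMetric_eq, Matrix.diagonal_mul_diagonal, ← Matrix.diagonal_one]
  congr 1
  funext i
  exact inv_mul_cancel₀ (metricEntry_pos hα (hfpos _ hp.1) hp.2 i).ne'

theorem hasDerivAt_of_mem {u : ℝ → ℝ} {s : Set ℝ} (hs : IsOpen s) (hu : ContDiffOn ℝ ∞ u s) {x : ℝ}
    (hx : x ∈ s) : HasDerivAt u (deriv u x) x :=
  ((hu.contDiffAt (hs.mem_nhds hx)).differentiableAt (by simp)).hasDerivAt

theorem hasDerivAt_deriv_of_mem {u : ℝ → ℝ} {s : Set ℝ} (hs : IsOpen s)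
    (hu : ContDiffOn ℝ ∞ u s) {x : ℝ} (hx : x ∈ s) :
    HasDerivAt (deriv u) (deriv (deriv u) x) x :=
  hasDerivAt_of_mem hs (hu.deriv_of_isOpen hs (by simp)) hx

theorem pderiv_totalMetric (hα : 0 < α) (hI : IsOpen I) (hf : ContDiffOn ℝ ∞ f I)
    {p : Unit ⊕ Fin 3 → ℝ} (hp : p ∈ totalSet I) (i j l : Unit ⊕ Fin 3) :
    pderiv i (fun q => totalMetric α f q j l) p = if j = l then
      metricEntryDeriv α (f (p (Sum.inl ()))) (deriv f (p (Sum.inl ()))) (p (Sum.inr 1)) i j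
      else 0 := by
  have hd : DifferentiableAt ℝ (fun q => totalMetric α f q j l) p :=
    ((contDiffOn_totalMetric hα hf j l).contDiffAt
      ((isOpen_totalSet hI).mem_nhds hp)).differentiableAt (by simp)
  have hy : 0 < p (Sum.inr 1) := hp.2
  have hf' : HasDerivAt (fun s => f s ^ 2)
      (2 * f (p (Sum.inl ())) * deriv f (p (Sum.inl ()))) (p (Sum.inl ())) := by
    simpa using (hasDerivAt_of_mem hI hf hp.1).fun_pow 2
  have hf'' := hf'.div_const (α * p (Sum.inr 1) ^ 2)
  have hy' : HasDerivAt (fun y : ℝ => f (p (Sum.inl ())) ^ 2 / (α * y ^ 2))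
      (-(2 * f (p (Sum.inl ())) ^ 2) / (α * p (Sum.inr 1) ^ 3)) (p (Sum.inr 1)) := by
    refine ((hasDerivAt_const _ _).div (((hasDerivAt_id (p (Sum.inr 1))).pow 2).const_mul α)
      (by simp; constructor <;> positivity)).congr_deriv ?_
    simp
    field_simp
  refine pderiv_eq_of_hasDerivAt hd (.of_forall fun s => by
    rw [totalMetric_eq, Matrix.diagonal_apply]) ?_
  split_ifs with hjl
  · rcases index_cases i with rfl | rfl | rfl | rfl <;>
    rcases index_cases j with rfl | rfl | rfl | rfl <;>
    simp [metricEntry, metricEntryDeriv, hasDerivAt_const] <;> assumption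
  · exact hasDerivAt_const _ _

/-- Diagonality of the metric collapses the sum over `l` to `l = k`. -/
theorem christoffel_totalMetric (hα : 0 < α) (hI : IsOpen I) (hf : ContDiffOn ℝ ∞ f I)
    (hfpos : ∀ t ∈ I, 0 < f t) {p : Unit ⊕ Fin 3 → ℝ} (hp : p ∈ totalSet I)
    (k i j : Unit ⊕ Fin 3) :
    christoffel (totalMetric α f) k i j p
      = (2 * metricEntry α (f (p (Sum.inl ()))) (p (Sum.inr 1)) k)⁻¹ *
        ((if j = k then metricEntryDeriv α (f (p (Sum.inl ()))) (deriv f (p (Sum.inl ())))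
            (p (Sum.inr 1)) i j else 0)
        + (if i = k then metricEntryDeriv α (f (p (Sum.inl ()))) (deriv f (p (Sum.inl ())))
            (p (Sum.inr 1)) j i else 0)
        - (if i = j then metricEntryDeriv α (f (p (Sum.inl ()))) (deriv f (p (Sum.inl ())))
            (p (Sum.inr 1)) k i else 0)) := by
  simp only [christoffel, inv_totalMetric hα hfpos hp, pderiv_totalMetric hα hI hf hp,
    Matrix.diagonal_apply, ite_mul, zero_mul, Finset.sum_ite_eq, Finset.mem_univ, if_true]
  rw [mul_inv]
  ring

theorem contDiffOn_totalField (hφ : ContDiffOn ℝ ∞ φ I) (hb : ContDiffOn ℝ ∞ b (Set.Ioi 0))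
    (hc : ContDiffOn ℝ ∞ c (Set.Ioi 0)) : ContDiffOn ℝ ∞ (totalField α φ b c) (totalSet I) := by
  refine contDiffOn_pi.2 fun i => ?_
  rcases index_cases i with rfl | rfl | rfl | rfl
  · exact contDiffOn_comp_time hφ
  · simpa [totalField, sumField, e₂, e₃] using (contDiffOn_comp_height hb).mul
      ((contDiff_apply ℝ ℝ (Sum.inr 1 : Unit ⊕ Fin 3)).contDiffOn.mul
        (contDiffOn_const (c := Real.sqrt α)))
  · simpa [totalField, sumField, e₂, e₃] using contDiffOn_const
  · simpa [totalField, sumField, e₂, e₃] using contDiffOn_comp_height hc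

/-! ### Rough Laplacian of the field. -/

theorem totalField_apply (p : Unit ⊕ Fin 3 → ℝ) (k : Unit ⊕ Fin 3) :
    totalField α φ b c p k = (Sum.elim (fun _ => φ (p (Sum.inl ())))
      ![b (p (Sum.inr 1)) * (p (Sum.inr 1) * Real.sqrt α), 0, c (p (Sum.inr 1))] :
        Unit ⊕ Fin 3 → ℝ) k := by
  rcases index_cases k with rfl | rfl | rfl | rfl <;> simp [totalField, sumField, e₂, e₃]

theorem pderiv_totalField (hI : IsOpen I) (hφ : ContDiffOn ℝ ∞ φ I)
    (hb : ContDiffOn ℝ ∞ b (Set.Ioi 0)) (hc : ContDiffOn ℝ ∞ c (Set.Ioi 0))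
    {p : Unit ⊕ Fin 3 → ℝ} (hp : p ∈ totalSet I) (i k : Unit ⊕ Fin 3) :
    pderiv i (fun q => totalField α φ b c q k) p =
      (Sum.elim (fun _ => Sum.elim (fun _ => deriv φ (p (Sum.inl ()))) 0)
        ![0, Sum.elim (fun _ => 0) ![deriv b (p (Sum.inr 1)) * (p (Sum.inr 1) * Real.sqrt α)
          + b (p (Sum.inr 1)) * Real.sqrt α, 0, deriv c (p (Sum.inr 1))], 0] :
        Unit ⊕ Fin 3 → Unit ⊕ Fin 3 → ℝ) i k := by
  have hd : DifferentiableAt ℝ (fun q => totalField α φ b c q k) p :=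
    ((contDiffOn_pi.1 (contDiffOn_totalField hφ hb hc) k).contDiffAt
      ((isOpen_totalSet hI).mem_nhds hp)).differentiableAt (by simp)
  have hφ' := hasDerivAt_of_mem hI hφ hp.1
  have hc' := hasDerivAt_of_mem isOpen_Ioi hc hp.2
  have hb' : HasDerivAt (fun y => b y * (y * Real.sqrt α))
      (deriv b (p (Sum.inr 1)) * (p (Sum.inr 1) * Real.sqrt α)
        + b (p (Sum.inr 1)) * Real.sqrt α) (p (Sum.inr 1)) := by
    simpa using (hasDerivAt_of_mem isOpen_Ioi hb hp.2).fun_mul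
      ((hasDerivAt_id _).mul_const (Real.sqrt α))
  refine pderiv_eq_of_hasDerivAt hd (.of_forall fun s => by rw [totalField_apply]) ?_
  rcases index_cases i with rfl | rfl | rfl | rfl <;>
  rcases index_cases k with rfl | rfl | rfl | rfl <;>
  simp [hasDerivAt_const, -hasDerivAt_deriv_iff] <;> assumption

/-- The `(y, x)` entry contains `b'` but not `b`, because `e₂` is parallel along `∂_y`: the
derivative of its factor `y` cancels against `Γ^x_{yx}`. -/
theorem covDeriv_totalField (hα : 0 < α) (hI : IsOpen I) (hf : ContDiffOn ℝ ∞ f I)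
    (hfpos : ∀ t ∈ I, 0 < f t) (hφ : ContDiffOn ℝ ∞ φ I)
    (hb : ContDiffOn ℝ ∞ b (Set.Ioi 0)) (hc : ContDiffOn ℝ ∞ c (Set.Ioi 0))
    {p : Unit ⊕ Fin 3 → ℝ} (hp : p ∈ totalSet I) {t y : ℝ} (ht : p (Sum.inl ()) = t)
    (hy : p (Sum.inr 1) = y) (i k : Unit ⊕ Fin 3) :
    covDeriv (totalMetric α f) (totalField α φ b c) i k p =
      (Sum.elim
        (fun _ => Sum.elim (fun _ => deriv φ t)
          ![deriv f t * Real.sqrt α * y * b y / f t, 0, deriv f t * c y / f t])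
        ![Sum.elim (fun _ => -(f t * deriv f t * Real.sqrt α * b y) / (α * y))
            ![deriv f t * φ t / f t, Real.sqrt α * b y, 0],
          Sum.elim (fun _ => 0) ![Real.sqrt α * y * deriv b y, deriv f t * φ t / f t, deriv c y],
          Sum.elim (fun _ => -(f t * deriv f t * c y)) ![0, 0, deriv f t * φ t / f t]] :
        Unit ⊕ Fin 3 → Unit ⊕ Fin 3 → ℝ) i k := by
  have hF := hfpos _ hp.1
  have hy0 := hp.2
  simp only [ht] at hF
  replace hy0 : 0 < y := hy ▸ hy0
  rw [covDeriv, pderiv_totalField hI hφ hb hc hp]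
  simp only [christoffel_totalMetric hα hI hf hfpos hp, totalField_apply, Fintype.sum_sum_type,
    Fin.sum_univ_three, Finset.univ_unique, Finset.sum_singleton, ht, hy]
  generalize f t = F at *
  generalize deriv f t = F'
  rcases index_cases i with rfl | rfl | rfl | rfl <;>
  rcases index_cases k with rfl | rfl | rfl | rfl <;>
  simp [metricEntry, metricEntryDeriv] <;> try field_simp
  all_goals first | ring1 | simp

theorem momentum_totalField (hα : 0 < α) (hI : IsOpen I) (hf : ContDiffOn ℝ ∞ f I)
    (hfpos : ∀ t ∈ I, 0 < f t) (hφ : ContDiffOn ℝ ∞ φ I)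
    (hb : ContDiffOn ℝ ∞ b (Set.Ioi 0)) (hc : ContDiffOn ℝ ∞ c (Set.Ioi 0))
    {p : Unit ⊕ Fin 3 → ℝ} (hp : p ∈ totalSet I) {t y : ℝ} (ht : p (Sum.inl ()) = t)
    (hy : p (Sum.inr 1) = y) (i k : Unit ⊕ Fin 3) :
    momentum (totalMetric α f) (totalField α φ b c) i k p =
      (Sum.elim
        (fun _ => Sum.elim (fun _ => f t ^ 3 * deriv φ t / (α * y ^ 2))
          ![f t ^ 4 * deriv f t * (Real.sqrt α * b y / (α ^ 2 * y ^ 3)), 0,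
            f t ^ 4 * deriv f t * (c y / (α * y ^ 2))])
        ![Sum.elim (fun _ => -(f t ^ 2 * deriv f t * Real.sqrt α * b y) / (α * y))
            ![f t ^ 2 * deriv f t * φ t / (α * y ^ 2),
              f t ^ 3 * Real.sqrt α * b y / (α * y ^ 2), 0],
          Sum.elim (fun _ => 0) ![f t ^ 3 * Real.sqrt α / α * (deriv b y / y),
            f t ^ 2 * deriv f t * φ t / (α * y ^ 2), f t ^ 3 * deriv c y],
          Sum.elim (fun _ => -(f t ^ 2 * deriv f t * c y) / (α * y ^ 2))
            ![0, 0, f t ^ 2 * deriv f t * φ t / (α * y ^ 2)]] :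
        Unit ⊕ Fin 3 → Unit ⊕ Fin 3 → ℝ) i k := by
  have hF := hfpos _ hp.1
  have hy0 := hp.2
  simp only [ht] at hF
  replace hy0 : 0 < y := hy ▸ hy0
  have e : momentum (totalMetric α f) (totalField α φ b c) i k p
      = f t ^ 3 / (α * y ^ 2) * ((metricEntry α (f t) y i)⁻¹ * metricEntry α (f t) y k *
        covDeriv (totalMetric α f) (totalField α φ b c) i k p) := by
    rw [momentum, volumeDensity_totalMetric hα hfpos hp, inv_totalMetric hα hfpos hp, ht, hy]
    congr 1
    rw [Finset.sum_eq_single i (fun j _ hj => by simp [hj]) (by simp),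
      Finset.sum_eq_single k (fun j _ hj => by simp [totalMetric_eq, hj]) (by simp)]
    simp [totalMetric_eq, ht, hy]
  rw [e, covDeriv_totalField hα hI hf hfpos hφ hb hc hp ht hy]
  rcases index_cases i with rfl | rfl | rfl | rfl <;>
  rcases index_cases k with rfl | rfl | rfl | rfl <;>
  simp [metricEntry] <;> field_simp

/-- Only the divergence terms, differentiated in the direction of their own first index, are needed;
those in `x` and `z` vanish since nothing depends on these coordinates. -/
theorem pderiv_momentum_totalField (hα : 0 < α) (hI : IsOpen I) (hf : ContDiffOn ℝ ∞ f I)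
    (hfpos : ∀ t ∈ I, 0 < f t) (hφ : ContDiffOn ℝ ∞ φ I)
    (hb : ContDiffOn ℝ ∞ b (Set.Ioi 0)) (hc : ContDiffOn ℝ ∞ c (Set.Ioi 0))
    {p : Unit ⊕ Fin 3 → ℝ} (hp : p ∈ totalSet I) {t y : ℝ} (ht : p (Sum.inl ()) = t)
    (hy : p (Sum.inr 1) = y) (i l : Unit ⊕ Fin 3) :
    pderiv i (momentum (totalMetric α f) (totalField α φ b c) i l) p =
      (Sum.elim
        (fun _ => Sum.elim
          (fun _ => (3 * f t ^ 2 * deriv f t * deriv φ t + f t ^ 3 * deriv (deriv φ) t)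
            / (α * y ^ 2))
          ![(4 * f t ^ 3 * deriv f t * deriv f t + f t ^ 4 * deriv (deriv f) t)
              * (Real.sqrt α * b y / (α ^ 2 * y ^ 3)), 0,
            (4 * f t ^ 3 * deriv f t * deriv f t + f t ^ 4 * deriv (deriv f) t)
              * (c y / (α * y ^ 2))])
        ![0, Sum.elim (fun _ => 0)
          ![f t ^ 3 * Real.sqrt α / α * ((deriv (deriv b) y * y - deriv b y) / y ^ 2),
            -(2 * f t ^ 2 * deriv f t * φ t) / (α * y ^ 3), f t ^ 3 * deriv (deriv c) y], 0] :
        Unit ⊕ Fin 3 → Unit ⊕ Fin 3 → ℝ) i l := by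
  have hd : DifferentiableAt ℝ (momentum (totalMetric α f) (totalField α φ b c) i l) p :=
    ((contDiffOn_momentum (isOpen_totalSet hI) (contDiffOn_totalMetric hα hf)
      (fun q hq => det_totalMetric_ne_zero hα hfpos hq) (contDiffOn_totalField hφ hb hc)
      i l).contDiffAt ((isOpen_totalSet hI).mem_nhds hp)).differentiableAt (by simp)
  have htI : t ∈ I := ht ▸ hp.1
  have hy0 : 0 < y := hy ▸ hp.2
  have hF := hfpos t htI
  -- The closed form of `momentum` holds on `totalSet` only, so the coordinate line must stay inside
  -- it near `p`.
  have hev : ∀ᶠ s in nhds (p i), Function.update p i s ∈ totalSet I :=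
    (continuous_const.update i continuous_id).continuousAt.eventually_mem
      ((isOpen_totalSet hI).mem_nhds (by simpa using hp))
  have hf1 := hasDerivAt_of_mem hI hf htI
  have hf2 := hasDerivAt_deriv_of_mem hI hf htI
  have hb2 := hasDerivAt_deriv_of_mem isOpen_Ioi hb hy0
  have hc2 := hasDerivAt_deriv_of_mem isOpen_Ioi hc hy0
  have h00 : HasDerivAt (fun s => f s ^ 3 * deriv φ s / (α * y ^ 2))
      ((3 * f t ^ 2 * deriv f t * deriv φ t + f t ^ 3 * deriv (deriv φ) t) / (α * y ^ 2)) t := by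
    simpa using ((hf1.fun_pow 3).fun_mul (hasDerivAt_deriv_of_mem hI hφ htI)).div_const
      (α * y ^ 2)
  have h0 : HasDerivAt (fun s => f s ^ 4 * deriv f s)
      (4 * f t ^ 3 * deriv f t * deriv f t + f t ^ 4 * deriv (deriv f) t) t := by
    simpa using (hf1.fun_pow 4).fun_mul hf2
  have h01 := h0.mul_const (Real.sqrt α * b y / (α ^ 2 * y ^ 3))
  have h03 := h0.mul_const (c y / (α * y ^ 2))
  have h21 : HasDerivAt (fun s => f t ^ 3 * Real.sqrt α / α * (deriv b s / s))
      (f t ^ 3 * Real.sqrt α / α * ((deriv (deriv b) y * y - deriv b y) / y ^ 2)) y := by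
    simpa using (hb2.fun_div (hasDerivAt_id y) hy0.ne').const_mul (f t ^ 3 * Real.sqrt α / α)
  have h22 : HasDerivAt (fun s => f t ^ 2 * deriv f t * φ t / (α * s ^ 2))
      (-(2 * f t ^ 2 * deriv f t * φ t) / (α * y ^ 3)) y := by
    refine ((hasDerivAt_const _ _).fun_div (((hasDerivAt_id y).fun_pow 2).const_mul α)
      (mul_pos hα (pow_pos hy0 2)).ne').congr_deriv ?_
    simp
    field_simp
  have h23 := hc2.const_mul (f t ^ 3)
  refine pderiv_eq_of_hasDerivAt hd (hev.mono fun s hs => by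
    rw [momentum_totalField hα hI hf hfpos hφ hb hc hs rfl rfl]) ?_
  rcases index_cases i with rfl | rfl | rfl | rfl <;>
  rcases index_cases l with rfl | rfl | rfl | rfl <;>
  simp [hasDerivAt_const, ht, hy] <;> assumption

/-- In the `∂_y` component the divergence of the `φ` term cancels against the contributions of
`Γ^x_{xy}` and `Γ^y_{yy}`, both equal to `-1/y`. -/
theorem roughLaplacian_totalField (hα : 0 < α) (hI : IsOpen I) (hf : ContDiffOn ℝ ∞ f I)
    (hfpos : ∀ t ∈ I, 0 < f t) (hφ : ContDiffOn ℝ ∞ φ I)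
    (hb : ContDiffOn ℝ ∞ b (Set.Ioi 0)) (hc : ContDiffOn ℝ ∞ c (Set.Ioi 0))
    {p : Unit ⊕ Fin 3 → ℝ} (hp : p ∈ totalSet I) {t y : ℝ} (ht : p (Sum.inl ()) = t)
    (hy : p (Sum.inr 1) = y) (l : Unit ⊕ Fin 3) :
    roughLaplacian (totalMetric α f) (totalField α φ b c) l p =
      (Sum.elim (fun _ => -(f t ^ 3 / (α * y ^ 2)) *
          (deriv (deriv φ) t + 3 * (deriv f t / f t) * deriv φ t
            - 3 * (deriv f t / f t) ^ 2 * φ t))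
        ![-(f t ^ 3 * Real.sqrt α / (α ^ 2 * y ^ 3)) *
            ((f t * deriv (deriv f) t + 2 * deriv f t ^ 2) * b y
              + (α * y ^ 2 * deriv (deriv b) y - α * b y)), 0,
          -(f t ^ 3 / (α * y ^ 2)) *
            ((f t * deriv (deriv f) t + 2 * deriv f t ^ 2) * c y
              + α * y ^ 2 * deriv (deriv c) y)] : Unit ⊕ Fin 3 → ℝ) l := by
  have hy0 : 0 < y := hy ▸ hp.2
  have hF : 0 < f t := hfpos t (ht ▸ hp.1)
  simp only [roughLaplacian, momentum_totalField hα hI hf hfpos hφ hb hc hp ht hy,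
    pderiv_momentum_totalField hα hI hf hfpos hφ hb hc hp ht hy,
    christoffel_totalMetric hα hI hf hfpos hp, Fintype.sum_sum_type,
    Fin.sum_univ_three, Finset.univ_unique, Finset.sum_singleton, ht, hy]
  generalize f t = F at *
  generalize deriv f t = F'
  rcases index_cases l with rfl | rfl | rfl | rfl <;>
  simp [metricEntry, metricEntryDeriv] <;> field_simp <;> ring

/-! ### Reduction to ordinary differential equations and separation of variables. -/

theorem isHarmonicVectorField_totalField_iff (hα : 0 < α) (hI : IsOpen I)
    (hf : ContDiffOn ℝ ∞ f I) (hfpos : ∀ t ∈ I, 0 < f t) (hφ : ContDiffOn ℝ ∞ φ I)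
    (hb : ContDiffOn ℝ ∞ b (Set.Ioi 0)) (hc : ContDiffOn ℝ ∞ c (Set.Ioi 0)) :
    IsHarmonicVectorField (totalMetric α f) (totalSet I) (totalField α φ b c) ↔
      ∀ t ∈ I, ∀ y : ℝ, 0 < y →
        deriv (deriv φ) t + 3 * (deriv f t / f t) * deriv φ t
          - 3 * (deriv f t / f t) ^ 2 * φ t = 0 ∧
        (f t * deriv (deriv f) t + 2 * deriv f t ^ 2) * b y
          + (α * y ^ 2 * deriv (deriv b) y - α * b y) = 0 ∧
        (f t * deriv (deriv f) t + 2 * deriv f t ^ 2) * c y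
          + α * y ^ 2 * deriv (deriv c) y = 0 := by
  rw [isHarmonicVectorField_iff (isOpen_totalSet hI) (contDiffOn_totalMetric hα hf)
    (fun p _ => isSymm_totalMetric α f p) (fun q hq => det_totalMetric_ne_zero hα hfpos hq)
    (contDiffOn_totalField hφ hb hc)]
  have hsα := Real.sqrt_pos.2 hα
  constructor
  · intro h t ht y hy
    -- The equations do not involve `x` and `z`, so these coordinates are set to `0`.
    have hp : (Sum.elim (fun _ => t) ![0, y, 0] : Unit ⊕ Fin 3 → ℝ) ∈ totalSet I :=
      ⟨by simpa [lineSet] using ht, by simpa [fibreSet] using hy⟩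
    have h' := fun l => (roughLaplacian_totalField hα hI hf hfpos hφ hb hc hp (t := t) (y := y)
      (by simp) (by simp) l).symm.trans (h l _ hp)
    have hF := hfpos t ht
    exact ⟨(mul_eq_zero.1 (h' (Sum.inl ()))).resolve_left (neg_ne_zero.2 (by positivity)),
      (mul_eq_zero.1 (h' (Sum.inr 0))).resolve_left (neg_ne_zero.2 (by positivity)),
      (mul_eq_zero.1 (h' (Sum.inr 2))).resolve_left (neg_ne_zero.2 (by positivity))⟩
  · intro h l p hp
    obtain ⟨h1, h2, h3⟩ := h _ hp.1 _ hp.2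
    rw [roughLaplacian_totalField hα hI hf hfpos hφ hb hc hp rfl rfl]
    rcases index_cases l with rfl | rfl | rfl | rfl
    · exact mul_eq_zero_of_right _ h1
    · exact mul_eq_zero_of_right _ h2
    · rfl
    · exact mul_eq_zero_of_right _ h3

theorem exists_separation_constant (hIne : I.Nonempty)
    (hbc : ∃ y : ℝ, 0 < y ∧ (b y ≠ 0 ∨ c y ≠ 0)) :
    (∀ t ∈ I, ∀ y : ℝ, 0 < y →
        deriv (deriv φ) t + 3 * (deriv f t / f t) * deriv φ t
          - 3 * (deriv f t / f t) ^ 2 * φ t = 0 ∧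
        (f t * deriv (deriv f) t + 2 * deriv f t ^ 2) * b y
          + (α * y ^ 2 * deriv (deriv b) y - α * b y) = 0 ∧
        (f t * deriv (deriv f) t + 2 * deriv f t ^ 2) * c y
          + α * y ^ 2 * deriv (deriv c) y = 0) ↔
      PhiEquation I f φ ∧ ∃ ε : ℝ, WarpingEquation I ε f ∧
        (∀ y : ℝ, 0 < y → α * y ^ 2 * deriv (deriv b) y = (α - ε) * b y) ∧
        (∀ y : ℝ, 0 < y → α * y ^ 2 * deriv (deriv c) y = -ε * c y) := by
  constructor
  · intro h
    obtain ⟨t₀, ht₀⟩ := hIne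
    -- The `φ` equation does not involve `y`, so any height serves; `ε` is the value of `f f'' + 2
    -- f'²` at `t₀`.
    refine ⟨fun t ht => (h t ht 1 one_pos).1,
      f t₀ * deriv (deriv f) t₀ + 2 * deriv f t₀ ^ 2, fun t ht => ?_, fun y hy => ?_,
      fun y hy => ?_⟩
    -- Subtracting the equations at `t` and `t₀` for the same `y` removes the `y`-derivatives and
    -- leaves a multiple of `b y` or `c y`, which cancels.
    · obtain ⟨y, hy, hbc⟩ := hbc
      obtain ⟨-, hb1, hc1⟩ := h t ht y hy
      obtain ⟨-, hb0, hc0⟩ := h t₀ ht₀ y hy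
      rcases hbc with hne | hne
      · exact mul_right_cancel₀ hne (by linarith)
      · exact mul_right_cancel₀ hne (by linarith)
    · linarith [(h t₀ ht₀ y hy).2.1]
    · linarith [(h t₀ ht₀ y hy).2.2]
  · rintro ⟨hφ, ε, hε, hb, hc⟩ t ht y hy
    rw [hε t ht]
    exact ⟨hφ t ht, by linarith [hb y hy], by linarith [hc y hy]⟩

end TotalSpace

end WarpedHarmonic

end

theorem mainTheorem7 (α : ℝ) (hα : 0 < α)
    (I : Set ℝ) (hIopen : IsOpen I) (hIinterval : I.OrdConnected) (hIne : I.Nonempty)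
    (f φ b c : ℝ → ℝ)
    (hf : ContDiffOn ℝ ∞ f I) (hfpos : ∀ t ∈ I, 0 < f t)
    (hφ : ContDiffOn ℝ ∞ φ I)
    (hb : ContDiffOn ℝ ∞ b (Set.Ioi 0)) (hc : ContDiffOn ℝ ∞ c (Set.Ioi 0))
    (hbc : ∃ y : ℝ, 0 < y ∧ (b y ≠ 0 ∨ c y ≠ 0)) :
    (WarpedHarmonic.IsHarmonicVectorField (WarpedHarmonic.totalMetric α f)
        (WarpedHarmonic.totalSet I) (WarpedHarmonic.totalField α φ b c) ↔
      WarpedHarmonic.PhiEquation I f φ ∧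
      ∃ ε : ℝ, WarpedHarmonic.WarpingEquation I ε f ∧
        (∀ y : ℝ, 0 < y → α * y ^ 2 * deriv (deriv b) y = (α - ε) * b y) ∧
        (∀ y : ℝ, 0 < y → α * y ^ 2 * deriv (deriv c) y = -ε * c y)) ∧
    (WarpedHarmonic.IsHarmonicVectorField (WarpedHarmonic.totalMetric α f)
        (WarpedHarmonic.totalSet I) (WarpedHarmonic.totalField α φ b c) ↔
      WarpedHarmonic.PhiEquation I f φ ∧
      ∃ ε : ℝ, WarpedHarmonic.WarpingEquation I ε f ∧
        WarpedHarmonic.ExplicitB α ε b ∧ WarpedHarmonic.ExplicitC α ε c) := by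
  have h1 := (WarpedHarmonic.isHarmonicVectorField_totalField_iff hα hIopen hf hfpos hφ hb hc).trans
    (WarpedHarmonic.exists_separation_constant hIne hbc)
  refine ⟨h1, h1.trans (and_congr_right fun _ => exists_congr fun ε => and_congr_right fun _ => ?_)⟩
  exact and_congr (WarpedHarmonic.explicitB_iff hα hb) (WarpedHarmonic.explicitC_iff hα hc)
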